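/- All Hilbert spaces are finite-dimensional and $\log$ is to base $2$. A state is a positive semidefinite operator of trace $1$, a sub-normalized state one of trace at most $1$. For sub-normalized $\rho,\sigma$ let $F(\rho,\sigma)=\|\sqrt\rho\sqrt\sigma\|_1+\sqrt{(1-\mathrm{Tr}\rho)(1-\mathrm{Tr}\sigma)}$, $P(\rho,\sigma)=\sqrt{1-F(\rho,\sigma)^2}$ and $\delta(\rho,\sigma)=\frac12\left(\|\rho-\sigma\|_1+|\mathrm{Tr}(\rho-\sigma)|\right)$, and let $B_\varepsilon(\rho)$, $B^{\mathrm{Tr}}_\varepsilon(\rho)$ be the sets of sub-normalized states at $P$-distance, respectively $\delta$-distance, at most $\varepsilon$ from $\rho$. Put $$H_{\min}(A|B)_\rho=\sup_{\sigma_B\text{ state}}\sup\{\lambda\in\mathbb R: 2^{-\lambda}1_A\otimes\sigma_B\ge\rho_{AB}\},\qquad H_{\max}(A|B)_\rho=-H_{\min}(A|C)_\rho,$$ where $\rho_{ABC}$ is a purification of $\rho_{AB}$, and $$I_{\max}(E;A)_\rho=\inf_{\sigma_A\text{ state}}\inf\{\lambda\in\mathbb R: 2^{\lambda}\sigma_A\otimes\rho_E\ge\rho_{AE}\}.$$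 The smooth quantities are $H^\varepsilon_{\min}(A|B)_\rho=\sup_{\tilde\rho\in B_\varepsilon(\rho)}H_{\min}(A|B)_{\tilde\rho}$, $H^\varepsilon_{\max}(A|B)_\rho=\inf_{\tilde\rho\in B_\varepsilon(\rho)}H_{\max}(A|B)_{\tilde\rho}$, $I^\varepsilon_{\max}(E;A)_\rho=\inf_{\tilde\rho\in B_\varepsilon(\rho)}I_{\max}(E;A)_{\tilde\rho}$; $H_{\min}^{\varepsilon,\mathrm{Tr}}$ is $H^\varepsilon_{\min}$ with $B^{\mathrm{Tr}}_\varepsilon$ in place of $B_\varepsilon$. Unconditional entropies have a trivial conditioning system, and a probability distribution $p$ is identified with its diagonal density matrix. (1) Let $0<q<1$, $\varepsilon\ge0$, $\varepsilon^2<1-\sqrt{1-q}$, and let $\Phi$ be a maximally entangled state of $A\otimes B$ with $\dim A=\dim B=d$. Then $$H_{\min}^{\varepsilon}(A|B)_{q\Phi}\le-\log d+\log\frac{1}{1-\varepsilon^2-\sqrt{1-q}}.$$ For $n\ge1$ and $0<p_0<1$ let $p$ be the distribution on $\{0,1,\dots,n\}$ with $p(0)=p_0$ and $p(i)=(1-p_0)/n$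 for $i\ne0$. Let $\varepsilon\ge0$. (2) If $\varepsilon\le p_0-(1-p_0)/n$, then $H_{\min}^\varepsilon(p)\le H_{\min}^{\varepsilon,\mathrm{Tr}}(p)=-\log(p_0-\varepsilon)$. (3) If $\varepsilon^2<1-\sqrt{p_0}$, then $H_{\max}^\varepsilon(p)\ge\log n-\log\frac{1}{1-\varepsilon^2-\sqrt{p_0}}$. (4) If $p_0=\frac12$ and $\varepsilon<\frac1{15}$, then $$H_{\max}^\varepsilon(p)-H_{\min}^\varepsilon(p)\ge\log n-\log\frac{10}{1-15\varepsilon}.$$ (5) Consequently the gap between the standard decoupling achievability bound $\frac12\left(H^{\varepsilon/5}_{\max}(A)_\rho-H^{\varepsilon/5}_{\min}(A|E)_\rho\right)$ and the converse bound $\frac12I^\varepsilon_{\max}(E;A)_\rho$ is unbounded: let $0\le\varepsilon<\frac13$, let $E$ be trivial, and let $\rho^{(n)}$ be the state of the distribution $p$ with $p_0=\frac12$. Then the converse bound is $0$ for every $n\ge1$, and for every $K\in\mathbb R$ the gap for $\rho^{(n)}$ is at least $K$ for all sufficiently large $n$. -/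

import Mathlib

open scoped MatrixOrder ComplexOrder Kronecker

noncomputable section

namespace QInfo

/-! Operators on a finite-dimensional Hilbert space with orthonormal basis indexed by `A` are
matrices `Matrix A A ℂ`; the system `A ⊗ B` has basis `A × B`; `X ≤ Y` is the Loewner order
(`Y - X` positive semidefinite). All logarithms are to base `2`. -/

/-- Normalized quantum states. -/
def IsState {A : Type*} [Fintype A] (ρ : Matrix A A ℂ) : Prop :=
  ρ.PosSemidef ∧ ρ.trace = 1

/-- Sub-normalized quantum states. -/
def IsSubState {A : Type*} [Fintype A] (ρ : Matrix A A ℂ) : Prop :=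
  ρ.PosSemidef ∧ ρ.trace.re ≤ 1

/-- The trace norm `‖X‖₁ = Tr √(X† X)`. -/
def traceNorm {A : Type*} [Fintype A] [DecidableEq A] (X : Matrix A A ℂ) : ℝ :=
  (CFC.sqrt (X.conjTranspose * X)).trace.re

/-- The generalized trace distance. -/
def traceDistance {A : Type*} [Fintype A] [DecidableEq A] (ρ σ : Matrix A A ℂ) : ℝ :=
  (traceNorm (ρ - σ) + |(ρ - σ).trace.re|) / 2

/-- The generalized fidelity `‖√ρ √σ‖₁ + √((1 - Tr ρ)(1 - Tr σ))`. -/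
def fidelity {A : Type*} [Fintype A] [DecidableEq A] (ρ σ : Matrix A A ℂ) : ℝ :=
  traceNorm (CFC.sqrt ρ * CFC.sqrt σ) + √((1 - ρ.trace.re) * (1 - σ.trace.re))

/-- The purified distance. -/
def purifiedDistance {A : Type*} [Fintype A] [DecidableEq A] (ρ σ : Matrix A A ℂ) : ℝ :=
  √(1 - fidelity ρ σ ^ 2)

/-- The purified distance ball of sub-normalized states. -/
def purifiedBall {A : Type*} [Fintype A] [DecidableEq A] (ε : ℝ) (ρ : Matrix A A ℂ) :
    Set (Matrix A A ℂ) :=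
  {ρ' | IsSubState ρ' ∧ purifiedDistance ρ ρ' ≤ ε}

/-- The trace distance ball of sub-normalized states. -/
def traceBall {A : Type*} [Fintype A] [DecidableEq A] (ε : ℝ) (ρ : Matrix A A ℂ) :
    Set (Matrix A A ℂ) :=
  {ρ' | IsSubState ρ' ∧ traceDistance ρ ρ' ≤ ε}

/-- The marginal `ρ_A = Tr_B ρ_AB`. -/
def marginalLeft {A B : Type*} [Fintype B] (ρ : Matrix (A × B) (A × B) ℂ) : Matrix A A ℂ :=
  Matrix.of fun a a' => ∑ b, ρ (a, b) (a', b)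

/-- The marginal `ρ_B = Tr_A ρ_AB`. -/
def marginalRight {A B : Type*} [Fintype A] (ρ : Matrix (A × B) (A × B) ℂ) : Matrix B B ℂ :=
  Matrix.of fun b b' => ∑ a, ρ (a, b) (a, b')

/-- The rank-one operator `|ψ⟩⟨ψ|`. -/
def ketbra {A : Type*} (ψ : A → ℂ) : Matrix A A ℂ :=
  Matrix.vecMulVec ψ (star ψ)

/-- The conditional min-entropy
`H_min(A|B)_ρ = max_σ max {l | 2^{-l} 1_A ⊗ σ_B ≥ ρ_AB}`, over normalized states `σ_B`. It is
extended-real valued, so that the supremum carries no default value (it is `⊤` at `ρ = 0`). -/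
def condMinEntropy {A B : Type*} [Fintype A] [Fintype B] [DecidableEq A]
    (ρ : Matrix (A × B) (A × B) ℂ) : EReal :=
  sSup {x : EReal | ∃ (l : ℝ) (σ : Matrix B B ℂ), IsState σ ∧
    ρ ≤ ((2 : ℝ) ^ (-l)) • ((1 : Matrix A A ℂ) ⊗ₖ σ) ∧ x = (l : EReal)}

/-- The standard purification `|ρ⟩_{AB,C} = ∑_c √ρ |c⟩_{AB} ⊗ |c⟩_C` of `ρ_AB`, with purifying
system `C` a copy of `A ⊗ B`. -/
def purification {A B : Type*} [Fintype A] [Fintype B] [DecidableEq A] [DecidableEq B]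
    (ρ : Matrix (A × B) (A × B) ℂ) : (A × B) × (A × B) → ℂ :=
  fun x => CFC.sqrt ρ x.1 x.2

/-- The vector `purification ρ` does purify `ρ`. -/
theorem marginalLeft_purification {A B : Type*} [Fintype A] [Fintype B] [DecidableEq A]
    [DecidableEq B] {ρ : Matrix (A × B) (A × B) ℂ} (hρ : ρ.PosSemidef) :
    marginalLeft (ketbra (purification ρ)) = ρ := by
  have h1 : (CFC.sqrt ρ).conjTranspose = CFC.sqrt ρ :=
    (Matrix.nonneg_iff_posSemidef.mp (CFC.sqrt_nonneg ρ)).isHermitian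
  have h2 : CFC.sqrt ρ * CFC.sqrt ρ = ρ := CFC.sqrt_mul_sqrt_self ρ hρ.nonneg
  have h3 : CFC.sqrt ρ * (CFC.sqrt ρ).conjTranspose = ρ := by rw [h1, h2]
  ext x y
  conv_rhs => rw [← h3]
  simp [marginalLeft, ketbra, purification, Matrix.vecMulVec_apply, Matrix.mul_apply,
    Matrix.conjTranspose_apply]

/-- The reduced operator `ρ_AC` of the standard purification `|ρ⟩_{ABC}` of `ρ_AB`. -/
def complementary {A B : Type*} [Fintype A] [Fintype B] [DecidableEq A] [DecidableEq B]
    (ρ : Matrix (A × B) (A × B) ℂ) : Matrix (A × (A × B)) (A × (A × B)) ℂ :=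
  Matrix.of fun x y => ∑ b, ketbra (purification ρ) ((x.1, b), x.2) ((y.1, b), y.2)

/-- The conditional max-entropy, dual to the min-entropy: `H_max(A|B)_ρ = - H_min(A|C)_ρ` for a
purification `ρ_ABC` of `ρ_AB` (the value is the same for all purifications). -/
def condMaxEntropy {A B : Type*} [Fintype A] [Fintype B] [DecidableEq A] [DecidableEq B]
    (ρ : Matrix (A × B) (A × B) ℂ) : EReal :=
  -condMinEntropy (complementary ρ)

/-- The smooth conditional min-entropy `H_min^ε(A|B)_ρ`. -/
def smoothCondMinEntropy {A B : Type*} [Fintype A] [Fintype B] [DecidableEq A] [DecidableEq B]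
    (ε : ℝ) (ρ : Matrix (A × B) (A × B) ℂ) : EReal :=
  ⨆ ρ' ∈ purifiedBall ε ρ, condMinEntropy ρ'

/-- The min-entropy `H_min^{ε,Tr}(A|B)_ρ` smoothed over the trace distance ball. -/
def smoothCondMinEntropyTr {A B : Type*} [Fintype A] [Fintype B] [DecidableEq A] [DecidableEq B]
    (ε : ℝ) (ρ : Matrix (A × B) (A × B) ℂ) : EReal :=
  ⨆ ρ' ∈ traceBall ε ρ, condMinEntropy ρ'

/-- The smooth conditional max-entropy `H_max^ε(A|B)_ρ`. -/
def smoothCondMaxEntropy {A B : Type*} [Fintype A] [Fintype B] [DecidableEq A] [DecidableEq B]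
    (ε : ℝ) (ρ : Matrix (A × B) (A × B) ℂ) : EReal :=
  ⨅ ρ' ∈ purifiedBall ε ρ, condMaxEntropy ρ'

/-- The operator `ρ_A` regarded as an operator on `A ⊗ ℂ`, with a trivial second system. -/
def withTrivial {A : Type*} (ρ : Matrix A A ℂ) : Matrix (A × Unit) (A × Unit) ℂ :=
  Matrix.of fun x y => ρ x.1 y.1

/-- The unconditional smooth min-entropy: trivial conditioning system. -/
def smoothMinEntropy {A : Type*} [Fintype A] [DecidableEq A] (ε : ℝ) (ρ : Matrix A A ℂ) : EReal :=
  smoothCondMinEntropy ε (withTrivial ρ)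

/-- The unconditional min-entropy smoothed over the trace distance ball. -/
def smoothMinEntropyTr {A : Type*} [Fintype A] [DecidableEq A] (ε : ℝ) (ρ : Matrix A A ℂ) :
    EReal :=
  smoothCondMinEntropyTr ε (withTrivial ρ)

/-- The unconditional smooth max-entropy: trivial conditioning system. -/
def smoothMaxEntropy {A : Type*} [Fintype A] [DecidableEq A] (ε : ℝ) (ρ : Matrix A A ℂ) : EReal :=
  smoothCondMaxEntropy ε (withTrivial ρ)

/-- The max-mutual information
`I_max(E;A)_ρ = min_σ min {l | 2^l σ_A ⊗ ρ_E ≥ ρ_AE}`, over normalized states `σ_A`. -/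
def maxMutualInfo {A E : Type*} [Fintype A] [Fintype E] (ρ : Matrix (A × E) (A × E) ℂ) : EReal :=
  sInf {x : EReal | ∃ (l : ℝ) (σ : Matrix A A ℂ), IsState σ ∧
    ρ ≤ ((2 : ℝ) ^ l) • (σ ⊗ₖ marginalRight ρ) ∧ x = (l : EReal)}

/-- The smooth max-mutual information `I_max^ε(E;A)_ρ`. -/
def smoothMaxMutualInfo {A E : Type*} [Fintype A] [Fintype E] [DecidableEq A] [DecidableEq E]
    (ε : ℝ) (ρ : Matrix (A × E) (A × E) ℂ) : EReal :=
  ⨅ ρ' ∈ purifiedBall ε ρ, maxMutualInfo ρ'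

/-- The standard decoupling achievability bound on the remainder system size,
`(H_max^{ε/5}(A)_ρ - H_min^{ε/5}(A|E)_ρ) / 2`. -/
def achievabilityBound {A E : Type*} [Fintype A] [Fintype E] [DecidableEq A] [DecidableEq E]
    (ε : ℝ) (ρ : Matrix (A × E) (A × E) ℂ) : EReal :=
  ((1 / 2 : ℝ) : EReal) *
    (smoothMaxEntropy (ε / 5) (marginalLeft ρ) - smoothCondMinEntropy (ε / 5) ρ)

/-- The converse bound on the remainder system size, `I_max^ε(E;A)_ρ / 2`. -/
def converseBound {A E : Type*} [Fintype A] [Fintype E] [DecidableEq A] [DecidableEq E]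
    (ε : ℝ) (ρ : Matrix (A × E) (A × E) ℂ) : EReal :=
  ((1 / 2 : ℝ) : EReal) * smoothMaxMutualInfo ε ρ

/-- `ψ` is a maximally entangled unit vector of `A ⊗ B`, `dim A = dim B = d`: both marginals of
`|ψ⟩⟨ψ|` are the maximally mixed state. -/
def IsMaximallyEntangled {d : ℕ} (ψ : Fin d × Fin d → ℂ) : Prop :=
  (ketbra ψ).trace = 1 ∧
    marginalLeft (ketbra ψ) = ((d : ℂ)⁻¹) • (1 : Matrix (Fin d) (Fin d) ℂ) ∧
    marginalRight (ketbra ψ) = ((d : ℂ)⁻¹) • (1 : Matrix (Fin d) (Fin d) ℂ)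

/-- The distribution on `{0, 1, …, n}` with `p(0) = p₀` and `p(i) = (1 - p₀)/n` for `i ≠ 0`. -/
def atomUniform (n : ℕ) (p₀ : ℝ) : Fin (n + 1) → ℝ :=
  fun i => if i = 0 then p₀ else (1 - p₀) / n

/-- The diagonal density matrix of a distribution. -/
def diagState {A : Type*} [DecidableEq A] (p : A → ℝ) : Matrix A A ℂ :=
  Matrix.diagonal fun i => (p i : ℂ)

end QInfo

end

namespace QInfo

open Matrix

/-! Every smoothing bound comes from one estimate of the fidelity. By polar decomposition `‖√τ √ρ‖₁
= Re Tr(√τ √ρ K)` for a contraction `K`, and Cauchy–Schwarz bounds each expectation of `√ρ K` by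
that of `ρ`. For a `τ` split into two blocks of weights `c²` and `s²` (the atom and the rest, or
`q|ψ⟩⟨ψ|` and the missing trace) this gives `F ≤ c u + s v` with `u² + v² ≤ 1`. Planar trigonometry
then yields `F² ≤ u² + s` and `c² - u² ≤ ε`, so any nearby `ρ` keeps enough weight `u²`.

Entropy bounds follow by testing the operator inequality that defines `H_min` on one vector: `ψ`
itself, the atom, or, for `H_max`, a vector built from `K` on the complementary system. The last
sees amplitude `√n b`, where `b` is the weight amplitude outside the atom, while `1 ⊗ σ` contributes
at most `1`; this is the source of `log n`.

With `E` trivial, comparing traces forces `I_max ≥ 0`, and `σ = ρ` attains `0`, so the whole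
difference of entropies is a gap. -/

theorem diag_mono {ι : Type*} {P Q : Matrix ι ι ℂ} (h : P ≤ Q) (i : ι) : (P i i).re ≤ (Q i i).re := by
  have := (Complex.le_def.mp ((Matrix.le_iff.mp h).diag_nonneg (i := i))).1
  simpa using this

theorem posSemidef_diagState {ι : Type*} [DecidableEq ι] {p : ι → ℝ} (hp : ∀ i, 0 ≤ p i) : (diagState p).PosSemidef :=
  PosSemidef.diagonal fun i => by simpa using (Complex.zero_le_real.mpr (hp i))

/-! ### Contractions, trace norm and fidelity -/

section Contraction

variable {ι : Type*} [Fintype ι]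

theorem norm_star_dotProduct_sq_le (u v : ι → ℂ) :
    ‖star u ⬝ᵥ v‖ ^ 2 ≤ (star u ⬝ᵥ u).re * (star v ⬝ᵥ v).re := by
  have key : ∀ w : ι → ℂ, (star w ⬝ᵥ w).re = ∑ i, ‖w i‖ ^ 2 := by
    intro w
    simp only [dotProduct, Complex.re_sum, Pi.star_apply]
    refine Finset.sum_congr rfl fun i _ => ?_
    rw [Complex.star_def, mul_comm, Complex.mul_conj, Complex.ofReal_re, Complex.normSq_eq_norm_sq]
  rw [key, key]
  refine le_trans ?_ (Finset.sum_mul_sq_le_sq_mul_sq _ _ _)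
  refine pow_le_pow_left₀ (norm_nonneg _) ?_ 2
  refine (norm_sum_le _ _).trans (le_of_eq ?_)
  simp

theorem dotProduct_mulVec_mono {P Q : Matrix ι ι ℂ} (h : P ≤ Q) (w : ι → ℂ) :
    (star w ⬝ᵥ P *ᵥ w).re ≤ (star w ⬝ᵥ Q *ᵥ w).re := by
  have := (Complex.le_def.mp ((Matrix.le_iff.mp h).dotProduct_mulVec_nonneg w)).1
  rw [sub_mulVec, dotProduct_sub, Complex.sub_re] at this
  simpa using this

theorem trace_mono {P Q : Matrix ι ι ℂ} (h : P ≤ Q) : P.trace.re ≤ Q.trace.re := by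
  have := (Complex.le_def.mp (Matrix.le_iff.mp h).trace_nonneg).1
  rw [trace_sub, Complex.sub_re] at this
  simpa using this

theorem star_mulVec_dotProduct_mulVec (P Q : Matrix ι ι ℂ) (w : ι → ℂ) :
    star (P *ᵥ w) ⬝ᵥ Q *ᵥ w = star w ⬝ᵥ (Pᴴ * Q) *ᵥ w := by
  rw [star_mulVec, ← dotProduct_mulVec, mulVec_mulVec]

variable [DecidableEq ι]

theorem le_one_of_mul_self_eq {Q : Matrix ι ι ℂ} (h1 : Q.IsHermitian) (h2 : Q * Q = Q) : Q ≤ 1 := by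
  rw [Matrix.le_iff]
  have : (1 - Q) = (1 - Q)ᴴ * (1 - Q) := by
    rw [conjTranspose_sub, h1.eq, conjTranspose_one, sub_mul, mul_sub, mul_sub, h2]; simp
  rw [this]
  exact posSemidef_conjTranspose_mul_self _

/-- A contraction `K` attaining the trace norm, from the polar decomposition of `X`. -/
theorem exists_contraction_trace_mul (X : Matrix ι ι ℂ) :
    ∃ K : Matrix ι ι ℂ, K * Kᴴ ≤ 1 ∧ Kᴴ * K ≤ 1 ∧ (X * K).trace.re = traceNorm X := by
  set H := CFC.sqrt (Xᴴ * X) with hH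
  have hH0 : 0 ≤ H := CFC.sqrt_nonneg _
  have hHs : IsSelfAdjoint H := .of_nonneg hH0
  have hHH : H * H = Xᴴ * X :=
    CFC.sqrt_mul_sqrt_self _ (posSemidef_conjTranspose_mul_self X).nonneg
  -- Since `0⁻¹ = 0`, `G` is the pseudo-inverse of `H = |X|`. Then `X * G` is the partial isometry
  -- of the polar decomposition, and its adjoint is the required `K`.
  set G := cfc (fun x : ℝ => x⁻¹) H with hG
  have hcont : ∀ f : ℝ → ℝ, ContinuousOn f (spectrum ℝ H) :=
    fun f => H.finite_real_spectrum.continuousOn f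
  have hGs : Gᴴ = G := (cfc_predicate (R := ℝ) (fun x : ℝ => x⁻¹) H : IsSelfAdjoint _)
  have hid : H = cfc (fun x : ℝ => x) H := (cfc_id' ℝ H).symm
  have hGHH : G * H * H = H := by
    have : cfc (fun x : ℝ => x⁻¹ * x * x) H = cfc (fun x : ℝ => x) H := by
      congr 1; ext x; by_cases h : x = 0 <;> simp [h]
    rw [cfc_mul _ _ H (hcont _) (hcont _), cfc_mul _ _ H (hcont _) (hcont _), ← hid] at this
    exact this
  have hGHG : G * H * G = G := by
    have : cfc (fun x : ℝ => x⁻¹ * x * x⁻¹) H = cfc (fun x : ℝ => x⁻¹) H := by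
      congr 1; ext x; by_cases h : x = 0 <;> simp [h]
    rw [cfc_mul _ _ H (hcont _) (hcont _), cfc_mul _ _ H (hcont _) (hcont _), ← hid] at this
    exact this
  have hKs : (G * Xᴴ)ᴴ = X * G := by rw [conjTranspose_mul, hGs, conjTranspose_conjTranspose]
  have hKK : G * Xᴴ * (X * G) = H * G := by
    calc G * Xᴴ * (X * G) = G * (Xᴴ * X) * G := by simp only [Matrix.mul_assoc]
      _ = (G * H * H) * G := by rw [← hHH]; simp only [Matrix.mul_assoc]
      _ = H * G := by rw [hGHH]
  have hcomm : H * G = G * H := by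
    have : Commute _ _ := cfc_commute_cfc (fun x : ℝ => x) (fun x : ℝ => x⁻¹) H
    rw [← hid] at this
    exact this
  refine ⟨G * Xᴴ, ?_, ?_, ?_⟩
  · refine le_one_of_mul_self_eq (by simp [IsHermitian]) ?_
    rw [hKs, hKK, hcomm, ← Matrix.mul_assoc, hGHG]
  · refine le_one_of_mul_self_eq (by simp [IsHermitian]) ?_
    have : G * Xᴴ * (X * G) * (G * Xᴴ) = G * Xᴴ := by
      rw [hKK, hcomm, ← Matrix.mul_assoc, hGHG]
    rw [hKs]
    calc X * G * (G * Xᴴ) * (X * G * (G * Xᴴ)) = X * G * (G * Xᴴ * (X * G) * (G * Xᴴ)) := by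
          simp only [Matrix.mul_assoc]
      _ = _ := by rw [this]
  · rw [Matrix.trace_mul_comm, Matrix.mul_assoc, ← hHH, ← Matrix.mul_assoc, hGHH]; rfl

theorem conjTranspose_sqrt (ρ : Matrix ι ι ℂ) : (CFC.sqrt ρ)ᴴ = CFC.sqrt ρ :=
  (Matrix.nonneg_iff_posSemidef.mp (CFC.sqrt_nonneg ρ)).isHermitian

/-- Cauchy–Schwarz for the vectors `√ρ w` and `K w`, the latter no longer than `w`. -/
theorem norm_sqrt_mul_contraction_sq_le {ρ K : Matrix ι ι ℂ} (hρ : ρ.PosSemidef) (hK : Kᴴ * K ≤ 1)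
    (w : ι → ℂ) :
    ‖star w ⬝ᵥ (CFC.sqrt ρ * K) *ᵥ w‖ ^ 2 ≤ (star w ⬝ᵥ ρ *ᵥ w).re * (star w ⬝ᵥ w).re := by
  have h := norm_star_dotProduct_sq_le (CFC.sqrt ρ *ᵥ w) (K *ᵥ w)
  rw [star_mulVec_dotProduct_mulVec, star_mulVec_dotProduct_mulVec, star_mulVec_dotProduct_mulVec,
    conjTranspose_sqrt, CFC.sqrt_mul_sqrt_self ρ hρ.nonneg] at h
  refine h.trans (mul_le_mul_of_nonneg_left ?_ ?_)
  · simpa using dotProduct_mulVec_mono hK w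
  · exact (Complex.le_def.mp (hρ.dotProduct_mulVec_nonneg w)).1

theorem norm_sqrt_mul_contraction_diag_sq_le {ρ K : Matrix ι ι ℂ} (hρ : ρ.PosSemidef)
    (hK : Kᴴ * K ≤ 1) (i : ι) : ‖(CFC.sqrt ρ * K) i i‖ ^ 2 ≤ (ρ i i).re := by
  have := norm_sqrt_mul_contraction_sq_le hρ hK (Pi.single i 1)
  have hs : star (Pi.single i 1 : ι → ℂ) = Pi.single i 1 := by
    rw [← Pi.single_star, star_one]
  simpa [hs] using this

theorem traceNorm_nonneg (X : Matrix ι ι ℂ) : 0 ≤ traceNorm X :=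
  (Complex.le_def.mp (Matrix.nonneg_iff_posSemidef.mp (CFC.sqrt_nonneg (Xᴴ * X))).trace_nonneg).1

theorem fidelity_nonneg (ρ σ : Matrix ι ι ℂ) : 0 ≤ fidelity ρ σ :=
  add_nonneg (traceNorm_nonneg _) (Real.sqrt_nonneg _)

theorem fidelity_sq_of_mem_ball {ε : ℝ} {ρ ρ' : Matrix ι ι ℂ} (h : ρ' ∈ purifiedBall ε ρ) :
    1 - ε ^ 2 ≤ fidelity ρ ρ' ^ 2 := by
  have := (Real.sqrt_le_iff.mp h.2).2
  linarith

theorem traceNorm_of_posSemidef {ρ : Matrix ι ι ℂ} (h : ρ.PosSemidef) :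
    traceNorm ρ = ρ.trace.re := by
  rw [traceNorm, h.isHermitian.eq, CFC.sqrt_mul_self ρ h.nonneg]

/-- Both `|T| - T` and `|T| + T` are positive: the first gives `2 T i i ≤ (|T| + T) i i`, the second
bounds that diagonal entry by the trace. -/
theorem two_mul_diag_le_traceNorm_add_trace {T : Matrix ι ι ℂ} (hT : T.IsHermitian) (i : ι) :
    2 * (T i i).re ≤ traceNorm T + T.trace.re := by
  have hs : IsSelfAdjoint T := hT
  have h1 : (CFC.abs T - T).PosSemidef := by
    rw [← Matrix.nonneg_iff_posSemidef, CFC.abs_sub_self T]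
    exact nsmul_nonneg (CFC.negPart_nonneg T) 2
  have h2 : (CFC.abs T + T).PosSemidef := by
    rw [← Matrix.nonneg_iff_posSemidef, CFC.abs_add_self T]
    exact nsmul_nonneg (CFC.posPart_nonneg T) 2
  have e1 : 0 ≤ ((CFC.abs T - T) i i).re := (Complex.le_def.mp (h1.diag_nonneg (i := i))).1
  have e2 : ((CFC.abs T + T) i i).re ≤ (CFC.abs T + T).trace.re := by
    rw [Matrix.trace, Complex.re_sum]
    exact Finset.single_le_sum (f := fun j => ((CFC.abs T + T) j j).re)
      (fun j _ => (Complex.le_def.mp (h2.diag_nonneg (i := j))).1) (Finset.mem_univ i)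
  have e3 : traceNorm T = (CFC.abs T).trace.re := rfl
  rw [trace_add] at e2
  simp only [Matrix.sub_apply, Matrix.add_apply, Complex.sub_re, Complex.add_re] at e1 e2
  linarith

theorem sqrt_diagState {p : ι → ℝ} (hp : ∀ i, 0 ≤ p i) :
    CFC.sqrt (diagState p) = diagState fun i => √(p i) := by
  refine CFC.sqrt_unique ?_ ?_
  · rw [diagState, diagState, diagonal_mul_diagonal]
    congr 1; ext i
    rw [← Complex.ofReal_mul, Real.mul_self_sqrt (hp i)]
  · exact (PosSemidef.diagonal fun i => by
      simp).nonneg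

theorem trace_diagState (p : ι → ℝ) : (diagState p).trace = ((∑ i, p i : ℝ) : ℂ) := by
  simp [diagState]

/-- The fidelity with a diagonal state is attained by a contraction. -/
theorem exists_contraction_fidelity_diagState {p : ι → ℝ} (hp : ∀ i, 0 ≤ p i) (hp1 : ∑ i, p i = 1)
    (ρ : Matrix ι ι ℂ) :
    ∃ K : Matrix ι ι ℂ, K * Kᴴ ≤ 1 ∧ Kᴴ * K ≤ 1 ∧
      fidelity (diagState p) ρ = ∑ i, √(p i) * ((CFC.sqrt ρ * K) i i).re := by
  obtain ⟨K, h1, h2, h3⟩ := exists_contraction_trace_mul (CFC.sqrt (diagState p) * CFC.sqrt ρ)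
  refine ⟨K, h1, h2, ?_⟩
  rw [fidelity, ← h3, trace_diagState, hp1, sqrt_diagState hp, Matrix.mul_assoc]
  simp [diagState, Matrix.trace, diagonal_mul]

end Contraction

/-! ### Planar trigonometry of overlaps -/

/-- Put `(c, s) = (cos α, sin α)` and `(u, w) = (cos β, sin β)`. Then `cos²(α - β) - cos² β = sin α
· sin(2β - α) ≤ sin α`. -/
theorem sq_le_add_of_overlap {c s u v F : ℝ} (hcs : c ^ 2 + s ^ 2 = 1) (hs : 0 ≤ s)
    (huv : u ^ 2 + v ^ 2 ≤ 1) (hF : 0 ≤ F) (h : F ≤ c * u + s * v) :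
    F ^ 2 ≤ u ^ 2 + s := by
  set w := √(1 - u ^ 2) with hw
  have hw2 : w ^ 2 = 1 - u ^ 2 := Real.sq_sqrt (by nlinarith)
  have hvw : v ≤ w := Real.le_sqrt_of_sq_le (by linarith)
  have h' : F ≤ c * u + s * w := h.trans (by gcongr)
  have h1 : F ^ 2 ≤ (c * u + s * w) ^ 2 := pow_le_pow_left₀ hF h' 2
  have h2 : (s * (w ^ 2 - u ^ 2) + c * (2 * u * w)) ^ 2 ≤ 1 := by
    -- The bracket is `sin(2β - α)`; adding the square of its companion cosine gives `1`.
    have e : (s * (w ^ 2 - u ^ 2) + c * (2 * u * w)) ^ 2 + (c * (w ^ 2 - u ^ 2) - s * (2 * u * w)) ^ 2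
        = (c ^ 2 + s ^ 2) * (w ^ 2 + u ^ 2) ^ 2 := by ring
    rw [hcs, show w ^ 2 + u ^ 2 = 1 by rw [hw2]; ring] at e
    linarith [sq_nonneg (c * (w ^ 2 - u ^ 2) - s * (2 * u * w))]
  have h3 : s * (w ^ 2 - u ^ 2) + c * (2 * u * w) ≤ 1 :=
    (abs_le_of_sq_le_sq' (by linarith) zero_le_one).2
  have h4 : (c * u + s * w) ^ 2 - u ^ 2 = s * (s * (w ^ 2 - u ^ 2) + c * (2 * u * w)) := by
    linear_combination u ^ 2 * hcs
  nlinarith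

/-- In the same angles, `cos² α - cos² β = sin(β - α) sin(β + α)`, and `sin²(β - α) = 1 - cos²(α -
β) ≤ 1 - F² ≤ ε²`. -/
theorem sub_sq_le_of_overlap {c s u v F ε : ℝ} (hcs : c ^ 2 + s ^ 2 = 1) (hs : 0 ≤ s)
    (huv : u ^ 2 + v ^ 2 ≤ 1) (hF : 0 ≤ F) (h : F ≤ c * u + s * v)
    (hε : 0 ≤ ε) (hFε : 1 - ε ^ 2 ≤ F ^ 2) : c ^ 2 - ε ≤ u ^ 2 := by
  set w := √(1 - u ^ 2) with hw
  have hw2 : w ^ 2 = 1 - u ^ 2 := Real.sq_sqrt (by nlinarith)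
  have hvw : v ≤ w := Real.le_sqrt_of_sq_le (by linarith)
  have h' : F ≤ c * u + s * w := h.trans (by gcongr)
  have h1 : F ^ 2 ≤ (c * u + s * w) ^ 2 := pow_le_pow_left₀ hF h' 2
  have e1 : (c * u + s * w) ^ 2 + (c * w - s * u) ^ 2 = 1 := by
    have : (c * u + s * w) ^ 2 + (c * w - s * u) ^ 2 = (c ^ 2 + s ^ 2) * (u ^ 2 + w ^ 2) := by ring
    rw [this, hcs, hw2]; ring
  have e2 : (c * w + s * u) ^ 2 ≤ 1 := by
    have : (c * w + s * u) ^ 2 + (c * u - s * w) ^ 2 = (c ^ 2 + s ^ 2) * (u ^ 2 + w ^ 2) := by ring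
    rw [hcs, hw2] at this
    nlinarith [sq_nonneg (c * u - s * w)]
  have e3 : c ^ 2 - u ^ 2 = (c * w - s * u) * (c * w + s * u) := by
    linear_combination (u ^ 2) * hcs - c ^ 2 * hw2
  have e4 : (c ^ 2 - u ^ 2) ^ 2 ≤ ε ^ 2 := by
    rw [e3, mul_pow]
    nlinarith [mul_le_mul_of_nonneg_left e2 (sq_nonneg (c * w - s * u))]
  have := abs_le_of_sq_le_sq' e4 hε
  linarith [this.2]

/-! ### Testing operator inequalities on vectors; the rescaled maximally entangled state -/

theorem ketbra_quadForm {ι : Type*} [Fintype ι] (r φ : ι → ℂ) :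
    (star φ ⬝ᵥ ketbra r *ᵥ φ).re = ‖star φ ⬝ᵥ r‖ ^ 2 := by
  have h : star r ⬝ᵥ φ = star (star φ ⬝ᵥ r) := by rw [star_dotProduct]
  rw [ketbra, vecMulVec_mulVec, dotProduct_smul, h]
  simp only [MulOpposite.smul_eq_mul_unop, MulOpposite.unop_op, Complex.star_def]
  rw [Complex.mul_conj, Complex.ofReal_re, Complex.normSq_eq_norm_sq]

theorem trace_ketbra {ι : Type*} [Fintype ι] (r : ι → ℂ) : (ketbra r).trace = star r ⬝ᵥ r := by
  rw [ketbra, trace_vecMulVec, dotProduct_comm]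

/-- Reduces a test of `1 ⊗ σ` to the marginal of the test vector; a marginal that is `≤ 1` or a
multiple of `1` then gives a bound uniform in the state `σ`. -/
theorem one_kronecker_quadForm {A B : Type*} [Fintype A] [Fintype B] [DecidableEq A]
    (σ : Matrix B B ℂ) (φ : A × B → ℂ) :
    star φ ⬝ᵥ ((1 : Matrix A A ℂ) ⊗ₖ σ) *ᵥ φ = (σ * marginalRight (ketbra φ)).trace := by
  simp only [dotProduct, mulVec, Fintype.sum_prod_type, kroneckerMap_apply, one_apply, Matrix.trace,
    Matrix.diag, mul_apply, marginalRight, ketbra, vecMulVec_apply, of_apply, Pi.star_apply,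
    ite_mul, zero_mul, one_mul, Finset.mul_sum]
  rw [Finset.sum_comm]
  refine Finset.sum_congr rfl fun j _ => ?_
  rw [Finset.sum_comm (s := (Finset.univ : Finset B))]
  refine Finset.sum_congr rfl fun i _ => ?_
  rw [Finset.sum_eq_single i (fun b _ hb => by simp [hb.symm]) (by simp)]
  refine Finset.sum_congr rfl fun k _ => ?_
  rw [if_pos rfl]
  ring

theorem trace_mul_le_trace {ι : Type*} [Fintype ι] [DecidableEq ι] {σ Q : Matrix ι ι ℂ}
    (hσ : σ.PosSemidef) (hQ : Q ≤ 1) : (σ * Q).trace.re ≤ σ.trace.re := by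
  have hT := CFC.sqrt_mul_sqrt_self σ hσ.nonneg
  have h := (Matrix.le_iff.mp hQ).conjTranspose_mul_mul_same (CFC.sqrt σ)
  have h0 := (Complex.le_def.mp h.trace_nonneg).1
  rw [conjTranspose_sqrt, Matrix.mul_sub, Matrix.sub_mul, Matrix.mul_one, trace_sub, Matrix.mul_assoc,
    trace_mul_comm _ (Q * _), Matrix.mul_assoc, hT, trace_mul_comm Q, Complex.sub_re] at h0
  simpa using h0

theorem condMinEntropy_le {A B : Type*} [Fintype A] [Fintype B] [DecidableEq A]
    {ρ : Matrix (A × B) (A × B) ℂ} {x : ℝ} (hx : 0 < x)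
    (h : ∀ (c : ℝ) (σ : Matrix B B ℂ), IsState σ → ρ ≤ c • ((1 : Matrix A A ℂ) ⊗ₖ σ) → x ≤ c) :
    condMinEntropy ρ ≤ ((-Real.logb 2 x : ℝ) : EReal) := by
  refine sSup_le ?_
  rintro _ ⟨l, σ, hσ, hle, rfl⟩
  rw [EReal.coe_le_coe_iff, le_neg]
  exact (Real.logb_le_iff_le_rpow one_lt_two hx).mpr (h _ σ hσ hle)

theorem le_condMinEntropy {A B : Type*} [Fintype A] [Fintype B] [DecidableEq A]
    {ρ : Matrix (A × B) (A × B) ℂ} {x : ℝ} (hx : 0 < x) {σ : Matrix B B ℂ} (hσ : IsState σ)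
    (h : ρ ≤ x • ((1 : Matrix A A ℂ) ⊗ₖ σ)) :
    ((-Real.logb 2 x : ℝ) : EReal) ≤ condMinEntropy ρ := by
  refine le_sSup ⟨-Real.logb 2 x, σ, hσ, ?_, rfl⟩
  rwa [neg_neg, Real.rpow_logb two_pos (by norm_num) hx]

theorem smul_quadForm {ι : Type*} [Fintype ι] (c : ℝ) (Q : Matrix ι ι ℂ) (w : ι → ℂ) :
    (star w ⬝ᵥ (c • Q) *ᵥ w).re = c * (star w ⬝ᵥ Q *ᵥ w).re := by
  rw [smul_mulVec, dotProduct_smul, Complex.smul_re, smul_eq_mul]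

theorem sqrt_smul_ketbra {ι : Type*} [Fintype ι] [DecidableEq ι] {ψ : ι → ℂ} {q : ℝ} (hq : 0 ≤ q)
    (hψ : star ψ ⬝ᵥ ψ = 1) : CFC.sqrt (q • ketbra ψ) = √q • ketbra ψ := by
  refine CFC.sqrt_unique ?_ ?_
  · rw [smul_mul_smul_comm, Real.mul_self_sqrt hq, ketbra, vecMulVec_mul_vecMulVec, hψ, one_smul]
  · exact smul_nonneg (Real.sqrt_nonneg q) (posSemidef_vecMulVec_self_star ψ).nonneg

/-- The overlap with `ψ` of an operator close to `q|ψ⟩⟨ψ|`. -/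
theorem le_quadForm_of_mem_ball {ι : Type*} [Fintype ι] [DecidableEq ι] {ψ : ι → ℂ} {q ε : ℝ}
    (hq : 0 ≤ q) (hq1 : q ≤ 1) (hψ : star ψ ⬝ᵥ ψ = 1) {ρ : Matrix ι ι ℂ}
    (hρ : ρ ∈ purifiedBall ε (q • ketbra ψ)) :
    1 - ε ^ 2 - √(1 - q) ≤ (star ψ ⬝ᵥ ρ *ᵥ ψ).re := by
  set x := (star ψ ⬝ᵥ ρ *ᵥ ψ).re with hx
  have hx0 : 0 ≤ x := (Complex.le_def.mp (hρ.1.1.dotProduct_mulVec_nonneg ψ)).1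
  have hQ1 : ketbra ψ ≤ 1 := by
    refine le_one_of_mul_self_eq (posSemidef_vecMulVec_self_star ψ).isHermitian ?_
    rw [ketbra, vecMulVec_mul_vecMulVec, hψ, one_smul]
  have hxt : x ≤ ρ.trace.re := by
    refine le_trans (le_of_eq ?_) (trace_mul_le_trace hρ.1.1 hQ1)
    rw [hx, ketbra, mul_vecMulVec, trace_vecMulVec, dotProduct_comm]
  obtain ⟨K, -, hK, hKF⟩ := exists_contraction_trace_mul (CFC.sqrt (q • ketbra ψ) * CFC.sqrt ρ)
  have hF : fidelity (q • ketbra ψ) ρ ≤ √q * √x + √(1 - q) * √(1 - ρ.trace.re) := by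
    rw [fidelity, ← hKF, ← Real.sqrt_mul (by linarith : 0 ≤ 1 - q)]
    have ht : (q • ketbra ψ).trace.re = q := by
      rw [trace_smul, trace_ketbra, hψ]; simp
    rw [ht]
    gcongr
    rw [sqrt_smul_ketbra hq hψ, smul_mul_assoc, smul_mul_assoc, trace_smul, Complex.smul_re,
      smul_eq_mul]
    gcongr
    rw [Matrix.mul_assoc, ketbra, vecMulVec_mul, trace_vecMulVec, dotProduct_comm,
      ← dotProduct_mulVec]
    refine (Complex.re_le_norm _).trans (Real.le_sqrt_of_sq_le ?_)
    have := norm_sqrt_mul_contraction_sq_le hρ.1.1 hK ψ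
    rwa [hψ, Complex.one_re, mul_one] at this
  -- The amplitudes are `u = √x` and `v = √(1 - Tr ρ)`; `u² + v² ≤ 1` is `x ≤ Tr ρ`.
  have h := sq_le_add_of_overlap (by rw [Real.sq_sqrt hq, Real.sq_sqrt (by linarith)]; ring)
    (Real.sqrt_nonneg _)
    (by rw [Real.sq_sqrt hx0, Real.sq_sqrt (by linarith [hρ.1.2])]; linarith)
    (fidelity_nonneg _ _) hF
  rw [Real.sq_sqrt hx0] at h
  linarith [fidelity_sq_of_mem_ball hρ]

theorem smoothCondMinEntropy_smul_maximallyEntangled_le {d : ℕ} {ψ : Fin d × Fin d → ℂ} {q ε : ℝ}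
    (hψ : IsMaximallyEntangled ψ) (hq : 0 < q) (hq1 : q < 1) (hε : ε ^ 2 < 1 - √(1 - q)) :
    smoothCondMinEntropy ε (q • ketbra ψ) ≤
      ((-Real.logb 2 d + Real.logb 2 (1 / (1 - ε ^ 2 - √(1 - q))) : ℝ) : EReal) := by
  have hd : 0 < d := by
    rcases Nat.eq_zero_or_pos d with rfl | h
    · exact absurd hψ.1 (by simp [Matrix.trace])
    · exact h
  have hd' : (0 : ℝ) < d := Nat.cast_pos.mpr hd
  have hy : 0 < 1 - ε ^ 2 - √(1 - q) := by linarith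
  have e : -Real.logb 2 d + Real.logb 2 (1 / (1 - ε ^ 2 - √(1 - q))) =
      -Real.logb 2 (d * (1 - ε ^ 2 - √(1 - q))) := by
    rw [Real.logb_mul hd'.ne' hy.ne', one_div, Real.logb_inv]; ring
  have hn : star ψ ⬝ᵥ ψ = 1 := by rw [← trace_ketbra, hψ.1]
  rw [e]
  refine iSup₂_le fun ρ hρ => condMinEntropy_le (by positivity) fun c σ hσ hle => ?_
  -- Tested on `ψ`, whose marginal is `1/d`, the operator `c • (1 ⊗ σ)` gives `c/d` for every state
  -- `σ`.
  have h := (le_quadForm_of_mem_ball hq.le hq1.le hn hρ).trans (dotProduct_mulVec_mono hle ψ)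
  rw [smul_quadForm, one_kronecker_quadForm, hψ.2.2, mul_smul_comm, Matrix.mul_one, trace_smul,
    hσ.2] at h
  have e2 : ((d : ℂ)⁻¹ • (1 : ℂ)).re = (d : ℝ)⁻¹ := by
    rw [smul_eq_mul, mul_one, ← Complex.ofReal_natCast, ← Complex.ofReal_inv, Complex.ofReal_re]
  rw [e2, ← div_eq_mul_inv, le_div_iff₀ hd'] at h
  linarith

/-! ### Min-entropy of the distribution with an atom -/

theorem withTrivial_diagState {A : Type*} [DecidableEq A] (p : A → ℝ) :
    withTrivial (diagState p) = diagState fun x : A × Unit => p x.1 := by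
  ext x y
  simp [withTrivial, diagState, diagonal_apply, Prod.ext_iff]

theorem atomUniform_nonneg {n : ℕ} {p₀ : ℝ} (h0 : 0 ≤ p₀) (h1 : p₀ ≤ 1) (i : Fin (n + 1)) :
    0 ≤ atomUniform n p₀ i := by
  rw [atomUniform]
  split_ifs
  · exact h0
  · exact div_nonneg (by linarith) (Nat.cast_nonneg n)

theorem sum_atomUniform {n : ℕ} (hn : 1 ≤ n) (p₀ : ℝ) :
    ∑ x : Fin (n + 1) × Unit, atomUniform n p₀ x.1 = 1 := by
  have : (n : ℝ) ≠ 0 := by positivity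
  rw [Fintype.sum_prod_type]
  simp only [Finset.univ_unique, Finset.sum_singleton, Fin.sum_univ_succ, atomUniform,
    Fin.succ_ne_zero, if_true, if_false, Finset.sum_const, Finset.card_univ, Fintype.card_fin,
    nsmul_eq_mul]
  field_simp
  ring

/-- The fidelity of `p` with a nearby operator, in terms of two amplitudes: that of the atom, and
that of the maximally entangled vector on the remaining outcomes. -/
theorem exists_contraction_atomUniform {n : ℕ} {p₀ ε : ℝ} (hn : 1 ≤ n) (h0 : 0 ≤ p₀) (h1 : p₀ ≤ 1)
    {ρ : Matrix (Fin (n + 1) × Unit) (Fin (n + 1) × Unit) ℂ}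
    (hρ : ρ ∈ purifiedBall ε (withTrivial (diagState (atomUniform n p₀)))) :
    ∃ (K : Matrix (Fin (n + 1) × Unit) (Fin (n + 1) × Unit) ℂ) (a b F : ℝ),
      K * Kᴴ ≤ 1 ∧ a ^ 2 ≤ (ρ (0, ()) (0, ())).re ∧ 0 ≤ a ∧ 0 ≤ b ∧
      ‖∑ i : Fin n, (CFC.sqrt ρ * K) (i.succ, ()) (i.succ, ())‖ = √n * b ∧ a ^ 2 + b ^ 2 ≤ 1 ∧
      0 ≤ F ∧ 1 - ε ^ 2 ≤ F ^ 2 ∧ F ≤ √p₀ * a + √(1 - p₀) * b := by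
  have hn' : (0 : ℝ) < n := by positivity
  have hF := fidelity_sq_of_mem_ball hρ
  have hF0 := fidelity_nonneg (withTrivial (diagState (atomUniform n p₀))) ρ
  rw [withTrivial_diagState] at hF hF0
  obtain ⟨K, hK1, hK2, hKF⟩ := exists_contraction_fidelity_diagState
    (p := fun x : Fin (n + 1) × Unit => atomUniform n p₀ x.1)
    (fun x => atomUniform_nonneg h0 h1 x.1) (sum_atomUniform hn p₀) ρ
  set M := CFC.sqrt ρ * K with hM
  set S := ∑ i : Fin n, M (i.succ, ()) (i.succ, ()) with hS
  have hd := norm_sqrt_mul_contraction_diag_sq_le hρ.1.1 hK2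
  have hsum : ‖M (0, ()) (0, ())‖ ^ 2 + ∑ i : Fin n, ‖M (i.succ, ()) (i.succ, ())‖ ^ 2 ≤ 1 := by
    refine le_trans ?_ hρ.1.2
    rw [Matrix.trace, Complex.re_sum, Fintype.sum_prod_type]
    simp only [Finset.univ_unique, Finset.sum_singleton, Fin.sum_univ_succ, diag_apply]
    exact add_le_add (hd _) (Finset.sum_le_sum fun i _ => hd _)
  -- Cauchy–Schwarz over the `n` equal outcomes makes `b = ‖S‖ / √n` satisfy `a² + b² ≤ Tr ρ ≤ 1`.
  have hS2 : ‖S‖ ^ 2 ≤ n * ∑ i : Fin n, ‖M (i.succ, ()) (i.succ, ())‖ ^ 2 := by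
    refine (pow_le_pow_left₀ (norm_nonneg _) (norm_sum_le _ _) 2).trans ?_
    simpa using sq_sum_le_card_mul_sum_sq (s := (Finset.univ : Finset (Fin n)))
      (f := fun i => ‖M (i.succ, ()) (i.succ, ())‖)
  refine ⟨K, ‖M (0, ()) (0, ())‖, ‖S‖ / √n, _, hK1, hd _, norm_nonneg _, by positivity, ?_, ?_,
    hF0, hF, ?_⟩
  · rw [mul_div_cancel₀ _ (Real.sqrt_pos.mpr hn').ne']
  · rw [div_pow, Real.sq_sqrt hn'.le]
    have : ‖S‖ ^ 2 / n ≤ ∑ i : Fin n, ‖M (i.succ, ()) (i.succ, ())‖ ^ 2 := by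
      rw [div_le_iff₀ hn']; linarith
    linarith
  · rw [hKF, Fintype.sum_prod_type]
    simp only [Finset.univ_unique, Finset.sum_singleton, Fin.sum_univ_succ, atomUniform,
      Fin.succ_ne_zero, if_true, if_false]
    rw [← Finset.mul_sum, Real.sqrt_div (by linarith)]
    refine add_le_add ?_ ?_
    · gcongr
      exact Complex.re_le_norm _
    · rw [div_mul_eq_mul_div, mul_div_assoc]
      gcongr
      rw [← Complex.re_sum]
      exact Complex.re_le_norm _

theorem sq_sqrt_add_sq_sqrt {p₀ : ℝ} (h0 : 0 ≤ p₀) (h1 : p₀ ≤ 1) :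
    √p₀ ^ 2 + √(1 - p₀) ^ 2 = 1 := by
  rw [Real.sq_sqrt h0, Real.sq_sqrt (by linarith)]; ring

theorem condMinEntropy_le_of_diag {A : Type*} [Fintype A] [DecidableEq A]
    {ρ : Matrix (A × Unit) (A × Unit) ℂ} {x : ℝ} (hx : 0 < x) (i : A)
    (h : x ≤ (ρ (i, ()) (i, ())).re) :
    condMinEntropy ρ ≤ ((-Real.logb 2 x : ℝ) : EReal) := by
  refine condMinEntropy_le hx fun c σ hσ hle => h.trans ((diag_mono hle _).trans (le_of_eq ?_))
  have : σ () () = 1 := by simpa [Matrix.trace] using hσ.2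
  simp [this]

theorem smoothMinEntropy_atomUniform_le {n : ℕ} {p₀ ε : ℝ} (hn : 1 ≤ n) (h0 : 0 ≤ p₀) (h1 : p₀ ≤ 1)
    (hε : 0 ≤ ε) (hεp : ε < p₀) :
    smoothMinEntropy ε (diagState (atomUniform n p₀)) ≤ ((-Real.logb 2 (p₀ - ε) : ℝ) : EReal) := by
  refine iSup₂_le fun ρ hρ => condMinEntropy_le_of_diag (by linarith) 0 ?_
  obtain ⟨K, a, b, F, -, ha, ha0, -, -, hab, hF0, hF, hFab⟩ :=
    exists_contraction_atomUniform hn h0 h1 hρ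
  have := sub_sq_le_of_overlap (sq_sqrt_add_sq_sqrt h0 h1) (Real.sqrt_nonneg _) hab hF0 hFab hε hF
  rw [Real.sq_sqrt h0] at this
  exact this.trans ha

theorem traceDistance_diagState {ι : Type*} [Fintype ι] [DecidableEq ι] {p q : ι → ℝ}
    (h : ∀ i, q i ≤ p i) :
    traceDistance (diagState p) (diagState q) = ∑ i, (p i - q i) := by
  have h0 : ∀ i, 0 ≤ p i - q i := fun i => sub_nonneg.mpr (h i)
  have e : diagState p - diagState q = diagState fun i => p i - q i := by
    simp [diagState, diagonal_sub]
  rw [traceDistance, e, traceNorm_of_posSemidef (posSemidef_diagState h0), trace_diagState,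
    Complex.ofReal_re, abs_of_nonneg (Finset.sum_nonneg fun i _ => h0 i)]
  ring

theorem smoothMinEntropyTr_atomUniform {n : ℕ} {p₀ ε : ℝ} (hn : 1 ≤ n) (h0 : 0 ≤ p₀) (h1 : p₀ < 1)
    (hε : 0 ≤ ε) (hεp : ε ≤ p₀ - (1 - p₀) / n) :
    smoothMinEntropyTr ε (diagState (atomUniform n p₀)) =
      ((-Real.logb 2 (p₀ - ε) : ℝ) : EReal) := by
  have hn' : (0 : ℝ) < n := by positivity
  have hpos : 0 < (1 - p₀) / n := div_pos (by linarith) hn'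
  have hx : 0 < p₀ - ε := by linarith
  refine le_antisymm (iSup₂_le fun ρ hρ => condMinEntropy_le_of_diag hx 0 ?_) ?_
  · have hh : (withTrivial (diagState (atomUniform n p₀)) - ρ).IsHermitian := by
      rw [withTrivial_diagState]
      have hp : (diagState fun x : Fin (n + 1) × Unit => atomUniform n p₀ x.1).PosSemidef :=
        posSemidef_diagState fun x => atomUniform_nonneg h0 h1.le x.1
      exact hp.isHermitian.sub hρ.1.1.isHermitian
    -- The generalized trace distance thus bounds the loss at the atom by `ε`, without a factor `2`.
    have h2 := two_mul_diag_le_traceNorm_add_trace hh (0, ())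
    have h3 := hρ.2
    rw [traceDistance] at h3
    have h4 := le_abs_self (withTrivial (diagState (atomUniform n p₀)) - ρ).trace.re
    have h5 : (withTrivial (diagState (atomUniform n p₀)) (0, ()) (0, ())).re = p₀ := by
      simp [withTrivial, diagState, atomUniform]
    rw [Matrix.sub_apply, Complex.sub_re, h5] at h2
    linarith
  -- The optimizer takes mass `ε` off the atom only; the hypothesis on `ε` says that the atom
  -- remains the largest entry.
  · set q : Fin (n + 1) × Unit → ℝ := fun x => if x.1 = 0 then p₀ - ε else (1 - p₀) / n with hq
    have hq0 : ∀ x, 0 ≤ q x := fun x => by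
      simp only [hq]; split_ifs <;> linarith
    have hqle : ∀ x, q x ≤ p₀ - ε := fun x => by
      simp only [hq]; split_ifs <;> linarith
    have hqp : ∀ x, q x ≤ atomUniform n p₀ x.1 := fun x => by
      simp only [hq, atomUniform]; split_ifs <;> linarith
    have hsum : ∑ x, (atomUniform n p₀ x.1 - q x) = ε := by
      rw [Fintype.sum_prod_type]
      simp [hq, atomUniform, Fin.sum_univ_succ]
    have hmem : diagState q ∈ traceBall ε (withTrivial (diagState (atomUniform n p₀))) := by
      refine ⟨⟨posSemidef_diagState hq0, ?_⟩, ?_⟩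
      · rw [trace_diagState, Complex.ofReal_re]
        exact (Finset.sum_le_sum fun x _ => hqp x).trans (sum_atomUniform hn p₀).le
      · rw [withTrivial_diagState, traceDistance_diagState hqp, hsum]
    refine le_trans (le_condMinEntropy (σ := 1) hx ⟨PosSemidef.one, by simp⟩ ?_)
      (le_iSup₂ (f := fun ρ _ => condMinEntropy ρ) _ hmem)
    have e : (p₀ - ε) • ((1 : Matrix (Fin (n + 1)) (Fin (n + 1)) ℂ) ⊗ₖ (1 : Matrix Unit Unit ℂ)) -
        diagState q = diagState fun x => p₀ - ε - q x := by
      rw [one_kronecker_one]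
      ext x y
      by_cases hxy : x = y <;> simp [diagState, one_apply, hxy]
    rw [Matrix.le_iff, e]
    exact posSemidef_diagState fun x => sub_nonneg.mpr (hqle x)

/-! ### Max-entropy of the distribution with an atom -/

/-- With `B` trivial nothing is traced out, so the complementary operator stays pure. -/
theorem complementary_eq_ketbra {A : Type*} [Fintype A] [DecidableEq A]
    (ρ : Matrix (A × Unit) (A × Unit) ℂ) :
    complementary ρ = ketbra fun x : A × (A × Unit) => CFC.sqrt ρ (x.1, ()) x.2 := by
  ext x y
  simp [complementary, ketbra, purification, vecMulVec_apply]

theorem le_smoothMaxEntropy_atomUniform {n : ℕ} {p₀ ε : ℝ} (hn : 1 ≤ n) (h0 : 0 ≤ p₀) (h1 : p₀ ≤ 1)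
    (hε : ε ^ 2 < 1 - √p₀) :
    ((Real.logb 2 n - Real.logb 2 (1 / (1 - ε ^ 2 - √p₀)) : ℝ) : EReal) ≤
      smoothMaxEntropy ε (diagState (atomUniform n p₀)) := by
  have hn' : (0 : ℝ) < n := by positivity
  have hy : 0 < 1 - ε ^ 2 - √p₀ := by linarith
  refine le_iInf₂ fun ρ hρ => ?_
  have e : Real.logb 2 n - Real.logb 2 (1 / (1 - ε ^ 2 - √p₀)) =
      - -Real.logb 2 (n * (1 - ε ^ 2 - √p₀)) := by
    rw [Real.logb_mul hn'.ne' hy.ne', one_div, Real.logb_inv]; ring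
  rw [e, condMaxEntropy, EReal.coe_neg, EReal.neg_le_neg_iff]
  obtain ⟨K, a, b, F, hK, ha, ha0, hb0, hSb, hab, hF0, hF, hFab⟩ :=
    exists_contraction_atomUniform hn h0 h1 hρ
  -- The roles are swapped here: `b` is the retained amplitude and the atom supplies the error `s =
  -- √p₀`.
  have hb : 1 - ε ^ 2 - √p₀ ≤ b ^ 2 := by
    have := sq_le_add_of_overlap (by rw [add_comm]; exact sq_sqrt_add_sq_sqrt h0 h1)
      (Real.sqrt_nonneg p₀) (by linarith : b ^ 2 + a ^ 2 ≤ 1) hF0 (by linarith)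
    linarith
  refine condMinEntropy_le (by positivity) fun c σ hσ hle => ?_
  -- The contraction read as a bipartite vector with the atom removed: its overlap with the
  -- purification is the partial trace sum of `√ρ K`, of modulus `√n b`.
  set φ : Fin (n + 1) × (Fin (n + 1) × Unit) → ℂ :=
    fun x => if x.1 = 0 then 0 else star (K x.2 (x.1, ())) with hφ
  have h := dotProduct_mulVec_mono hle φ
  rw [complementary_eq_ketbra, ketbra_quadForm, smul_quadForm, one_kronecker_quadForm] at h
  have hamp : star φ ⬝ᵥ (fun x : Fin (n + 1) × (Fin (n + 1) × Unit) => CFC.sqrt ρ (x.1, ()) x.2) =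
      ∑ i : Fin n, (CFC.sqrt ρ * K) (i.succ, ()) (i.succ, ()) := by
    simp only [dotProduct, hφ, Pi.star_apply]
    rw [Fintype.sum_prod_type, Fin.sum_univ_succ]
    simp [mul_apply, Fin.succ_ne_zero, mul_comm]
  have hmarg : marginalRight (ketbra φ) ≤ 1 := by
    -- The marginal of `φ` is `(K Kᴴ)ᵀ` minus the term of the omitted atom, which is itself a
    -- positive rank-one operator.
    have hsplit : (1 : Matrix (Fin (n + 1) × Unit) (Fin (n + 1) × Unit) ℂ) -
        marginalRight (ketbra φ) =
          (1 - K * Kᴴ)ᵀ + ketbra fun j => star (K j (0, ())) := by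
      ext j k
      simp only [Matrix.sub_apply, Matrix.add_apply, transpose_apply, marginalRight, ketbra, of_apply,
        vecMulVec_apply, mul_apply, conjTranspose_apply, Fintype.sum_prod_type, Fin.sum_univ_succ,
        Finset.univ_unique, Finset.sum_singleton, hφ, Pi.star_apply, one_apply]
      simp only [if_true, Fin.succ_ne_zero, if_false, star_zero, mul_zero, zero_add, star_star,
        eq_comm (a := k), mul_comm]
      ring
    rw [Matrix.le_iff, hsplit]
    exact (Matrix.le_iff.mp hK).transpose.add (posSemidef_vecMulVec_self_star _)
  have htr := trace_mul_le_trace hσ.1 hmarg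
  rw [hσ.2, Complex.one_re] at htr
  rw [hamp, hSb, mul_pow, Real.sq_sqrt hn'.le] at h
  have hnb : n * (1 - ε ^ 2 - √p₀) ≤ n * b ^ 2 := by gcongr
  have htr0 : 0 ≤ (σ * marginalRight (ketbra φ)).trace.re := by
    rw [← one_kronecker_quadForm (A := Fin (n + 1))]
    exact (Complex.le_def.mp ((PosSemidef.one.kronecker hσ.1).dotProduct_mulVec_nonneg φ)).1
  -- `c` is an arbitrary real, so its sign is needed before the trace factor can be replaced by its
  -- bound `1`.
  have hc : 0 < c := by
    by_contra! hc
    nlinarith [mul_pos hn' hy, mul_nonneg (neg_nonneg.mpr hc) htr0]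
  nlinarith

theorem le_smoothMaxEntropy_sub_smoothMinEntropy {n : ℕ} {ε : ℝ} (hn : 1 ≤ n) (hε : 0 ≤ ε)
    (hε' : ε < 1 / 15) :
    ((Real.logb 2 n - Real.logb 2 (10 / (1 - 15 * ε)) : ℝ) : EReal) ≤
      smoothMaxEntropy ε (diagState (atomUniform n (1 / 2))) -
        smoothMinEntropy ε (diagState (atomUniform n (1 / 2))) := by
  have hs : √(1 / 2 : ℝ) ≤ 0.7072 := Real.sqrt_le_iff.mpr (by norm_num)
  have hy : 0 < 1 - ε ^ 2 - √(1 / 2 : ℝ) := by nlinarith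
  have hz : 0 < 1 / 2 - ε := by linarith
  refine le_trans ?_ (EReal.sub_le_sub
    (le_smoothMaxEntropy_atomUniform hn (by norm_num) (by norm_num) (by linarith))
    (smoothMinEntropy_atomUniform_le hn (by norm_num) (by norm_num) hε (by linarith)))
  rw [← EReal.coe_sub, EReal.coe_le_coe_iff]
  -- Numerically, `1 - √(1/2) ≥ 0.2928` and `(0.2928 - ε²)(1/2 - ε) ≥ (1 - 15ε)/10`.
  have key : Real.logb 2 ((1 - 15 * ε) / 10) ≤
      Real.logb 2 ((1 - ε ^ 2 - √(1 / 2 : ℝ)) * (1 / 2 - ε)) := by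
    refine Real.logb_le_logb_of_le one_lt_two (by linarith) ?_
    have : 0.2928 - ε ^ 2 ≤ 1 - ε ^ 2 - √(1 / 2 : ℝ) := by linarith
    refine le_trans ?_ (mul_le_mul_of_nonneg_right this hz.le)
    nlinarith [pow_nonneg hε 3]
  rw [Real.logb_mul hy.ne' hz.ne'] at key
  rw [← inv_div, Real.logb_inv, one_div, Real.logb_inv]
  linarith

/-! ### The gap between the achievability and converse bounds -/

theorem isState_diagState_atomUniform {n : ℕ} {p₀ : ℝ} (hn : 1 ≤ n) (h0 : 0 ≤ p₀) (h1 : p₀ ≤ 1) :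
    IsState (diagState (atomUniform n p₀)) := by
  refine ⟨posSemidef_diagState fun i => atomUniform_nonneg h0 h1 i, ?_⟩
  have := sum_atomUniform hn p₀
  rw [Fintype.sum_prod_type] at this
  simp only [Finset.univ_unique, Finset.sum_singleton] at this
  rw [trace_diagState, this, Complex.ofReal_one]

theorem trace_withTrivial {A : Type*} [Fintype A] (ρ : Matrix A A ℂ) :
    (withTrivial ρ).trace = ρ.trace := by
  simp [withTrivial, Matrix.trace, Fintype.sum_prod_type]

theorem posSemidef_withTrivial {A : Type*} {ρ : Matrix A A ℂ} (h : ρ.PosSemidef) :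
    (withTrivial ρ).PosSemidef :=
  h.submatrix Prod.fst

theorem IsState.mem_purifiedBall {ι : Type*} [Fintype ι] [DecidableEq ι] {ρ : Matrix ι ι ℂ}
    (hρ : IsState ρ) {ε : ℝ} (hε : 0 ≤ ε) : ρ ∈ purifiedBall ε ρ := by
  refine ⟨⟨hρ.1, by simp [hρ.2]⟩, ?_⟩
  simp [purifiedDistance, fidelity, CFC.sqrt_mul_sqrt_self ρ hρ.1.nonneg,
    traceNorm_of_posSemidef hρ.1, hρ.2, hε]

/-- The marginal on the trivial system is the scalar `Tr ρ'`, so taking traces gives `Tr ρ' ≤ 2^l Tr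
ρ'`, hence `l ≥ 0`. The unsmoothed state with `σ = ρ` attains `l = 0`. -/
theorem smoothMaxMutualInfo_withTrivial {A : Type*} [Fintype A] [DecidableEq A]
    {ρ : Matrix A A ℂ} (hρ : IsState ρ) {ε : ℝ} (hε : 0 ≤ ε) (hε1 : ε < 1) :
    smoothMaxMutualInfo ε (withTrivial ρ) = 0 := by
  have hst : IsState (withTrivial ρ) :=
    ⟨posSemidef_withTrivial hρ.1, by rw [trace_withTrivial, hρ.2]⟩
  refine le_antisymm ?_ (le_iInf₂ fun ρ' hρ' => le_sInf ?_)
  · refine (iInf₂_le _ (hst.mem_purifiedBall hε)).trans (sInf_le ⟨0, ρ, hρ, le_of_eq ?_, by simp⟩)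
    have : marginalRight (withTrivial ρ) = 1 := by
      ext a b
      simpa [marginalRight, withTrivial, Matrix.trace] using hρ.2
    rw [this, Real.rpow_zero, one_smul]
    ext x y
    simp [withTrivial]
  · rintro _ ⟨l, σ, hσ, hle, rfl⟩
    have htr := trace_mono hle
    have hm : (marginalRight ρ').trace = ρ'.trace := by
      simp [marginalRight, Matrix.trace, Fintype.sum_prod_type]
    rw [trace_smul, trace_kronecker, hσ.2, one_mul, hm, Complex.smul_re, smul_eq_mul] at htr
    -- The zero operator has fidelity `0` with a normalized state, so `ε < 1` keeps it out of the
    -- ball.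
    have hpos : 0 < ρ'.trace.re := by
      refine lt_of_le_of_ne (Complex.le_def.mp hρ'.1.1.trace_nonneg).1 fun h => ?_
      have hz : ρ'.trace = 0 := Complex.ext h.symm
        (Complex.le_def.mp hρ'.1.1.trace_nonneg).2.symm
      rw [hρ'.1.1.trace_eq_zero_iff] at hz
      have hF := fidelity_sq_of_mem_ball hρ'
      rw [hz, fidelity, hst.2] at hF
      simp [traceNorm] at hF
      rw [abs_of_nonneg hε] at hF
      linarith
    have h1 : 1 ≤ (2 : ℝ) ^ l := by
      by_contra! h
      nlinarith
    have : 0 ≤ l := by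
      by_contra! h
      exact absurd (Real.rpow_lt_one_of_one_lt_of_neg one_lt_two h) (not_lt.mpr h1)
    exact EReal.coe_nonneg.mpr this

theorem marginalLeft_withTrivial {A : Type*} (ρ : Matrix A A ℂ) :
    marginalLeft (withTrivial ρ) = ρ := by
  ext a b
  simp [marginalLeft, withTrivial]

theorem le_achievabilityBound_atomUniform {n : ℕ} {ε : ℝ} (hn : 1 ≤ n) (hε : 0 ≤ ε)
    (hε' : ε < 1 / 3) :
    ((1 / 2 * (Real.logb 2 n - Real.logb 2 (10 / (1 - 3 * ε))) : ℝ) : EReal) ≤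
      achievabilityBound ε (withTrivial (diagState (atomUniform n (1 / 2)))) := by
  rw [achievabilityBound, marginalLeft_withTrivial, EReal.coe_mul]
  have := le_smoothMaxEntropy_sub_smoothMinEntropy (ε := ε / 5) hn (by linarith) (by linarith)
  rw [show 15 * (ε / 5) = 3 * ε by ring] at this
  exact mul_le_mul_of_nonneg_left this (EReal.coe_nonneg.mpr (by norm_num))

theorem converseBound_atomUniform {n : ℕ} {ε : ℝ} (hn : 1 ≤ n) (hε : 0 ≤ ε) (hε' : ε < 1) :
    converseBound ε (withTrivial (diagState (atomUniform n (1 / 2)))) = 0 := by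
  rw [converseBound, smoothMaxMutualInfo_withTrivial
    (isState_diagState_atomUniform hn (by norm_num) (by norm_num)) hε hε', mul_zero]

end QInfo

theorem mainTheorem9 :
    -- smoothing the rescaled maximally entangled state
    (∀ (d : ℕ) (ψ : Fin d × Fin d → ℂ) (q ε : ℝ), QInfo.IsMaximallyEntangled ψ →
      0 < q → q < 1 → 0 ≤ ε → ε ^ 2 < 1 - √(1 - q) →
      QInfo.smoothCondMinEntropy ε (q • QInfo.ketbra ψ) ≤
        ((-Real.logb 2 d + Real.logb 2 (1 / (1 - ε ^ 2 - √(1 - q))) : ℝ) : EReal)) ∧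
    -- smooth min-entropy of the distribution with atom `p₀`
    (∀ (n : ℕ) (p₀ ε : ℝ), 1 ≤ n → 0 < p₀ → p₀ < 1 → 0 ≤ ε → ε ≤ p₀ - (1 - p₀) / n →
      QInfo.smoothMinEntropy ε (QInfo.diagState (QInfo.atomUniform n p₀)) ≤
        QInfo.smoothMinEntropyTr ε (QInfo.diagState (QInfo.atomUniform n p₀)) ∧
      QInfo.smoothMinEntropyTr ε (QInfo.diagState (QInfo.atomUniform n p₀)) =
        ((-Real.logb 2 (p₀ - ε) : ℝ) : EReal)) ∧
    -- smooth max-entropy of the distribution with atom `p₀`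
    (∀ (n : ℕ) (p₀ ε : ℝ), 1 ≤ n → 0 < p₀ → p₀ < 1 → 0 ≤ ε → ε ^ 2 < 1 - √p₀ →
      ((Real.logb 2 n - Real.logb 2 (1 / (1 - ε ^ 2 - √p₀)) : ℝ) : EReal) ≤
        QInfo.smoothMaxEntropy ε (QInfo.diagState (QInfo.atomUniform n p₀))) ∧
    -- their difference for an atom of mass one half
    (∀ (n : ℕ) (ε : ℝ), 1 ≤ n → 0 ≤ ε → ε < 1 / 15 →
      ((Real.logb 2 n - Real.logb 2 (10 / (1 - 15 * ε)) : ℝ) : EReal) ≤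
        QInfo.smoothMaxEntropy ε (QInfo.diagState (QInfo.atomUniform n (1 / 2))) -
          QInfo.smoothMinEntropy ε (QInfo.diagState (QInfo.atomUniform n (1 / 2)))) ∧
    -- unbounded gap between the achievability bound and the converse (trivial system `E`)
    (∀ ε : ℝ, 0 ≤ ε → ε < 1 / 3 →
      (∀ n : ℕ, 1 ≤ n → QInfo.converseBound ε
        (QInfo.withTrivial (QInfo.diagState (QInfo.atomUniform n (1 / 2)))) = 0) ∧
      ∀ K : ℝ, ∃ N : ℕ, 1 ≤ N ∧ ∀ n : ℕ, N ≤ n →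
        (K : EReal) ≤
          QInfo.achievabilityBound ε
              (QInfo.withTrivial (QInfo.diagState (QInfo.atomUniform n (1 / 2)))) -
            QInfo.converseBound ε
              (QInfo.withTrivial (QInfo.diagState (QInfo.atomUniform n (1 / 2))))) := by

  refine ⟨fun d ψ q ε hψ hq hq1 _ hε =>
      QInfo.smoothCondMinEntropy_smul_maximallyEntangled_le hψ hq hq1 hε,
    fun n p₀ ε hn h0 h1 hε hεp => ?_,
    fun n p₀ ε hn h0 h1 _ hε => QInfo.le_smoothMaxEntropy_atomUniform hn h0.le h1.le hε,
    fun n ε hn hε hε' => QInfo.le_smoothMaxEntropy_sub_smoothMinEntropy hn hε hε',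
    fun ε hε hε' => ⟨fun n hn => QInfo.converseBound_atomUniform hn hε (by linarith), fun K => ?_⟩⟩
  · have e := QInfo.smoothMinEntropyTr_atomUniform hn h0.le h1 hε hεp
    have hpos : 0 < (1 - p₀) / n := div_pos (by linarith) (by positivity)
    -- The two smoothings are compared through the explicit value `-log(p₀ - ε)`, not through an
    -- inclusion of balls.
    exact ⟨e ▸ QInfo.smoothMinEntropy_atomUniform_le hn h0.le h1.le hε (by linarith), e⟩
  · have hlim : Filter.Tendsto (fun n : ℕ => Real.logb 2 n) Filter.atTop Filter.atTop :=
      (Real.tendsto_logb_atTop one_lt_two).comp tendsto_natCast_atTop_atTop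
    obtain ⟨N, hN⟩ := Filter.eventually_atTop.mp
      (hlim.eventually_ge_atTop (2 * K + Real.logb 2 (10 / (1 - 3 * ε))))
    refine ⟨max N 1, le_max_right _ _, fun n hn => ?_⟩
    have hn1 : 1 ≤ n := (le_max_right _ _).trans hn
    have hnN := hN n ((le_max_left _ _).trans hn)
    rw [QInfo.converseBound_atomUniform hn1 hε (by linarith), sub_zero]
    refine le_trans ?_ (QInfo.le_achievabilityBound_atomUniform hn1 hε hε')
    rw [EReal.coe_le_coe_iff]
    linarith
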